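/- Let $G$ be a connected Lie group with Lie algebra $\mathfrak g=T_eG$ and let $\mathbf G$ be a left invariant spray structure on $G$, i.e. a smooth vector field on $TG\setminus 0$ that is preserved by all left translations and has in every standard local coordinate system $(x^i,y^i)$ of $TG$ the form $\mathbf G=y^i\partial_{x^i}-2\mathbf G^i\partial_{y^i}$ with $\mathbf G^i(x,y)$ positively homogeneous of degree $2$ in $y$. Put $N^i_j=\partial\mathbf G^i/\partial y^j$. Let $\mathbf G_0=u^i\widetilde U_i$ be the canonical bi-invariant spray, where $U_i$ is the left invariant vector field extending the element $e_i$ of a basis of $\mathfrak g$, $\widetilde U_i$ is its complete lift to $TG$, and $u^i$ are the fibre coordinates given by $y=u^iU_i(g)\in T_gG$. Then $\mathbf H=\mathbf G_0-\mathbf G$ is tangent to the fibres of $TG$, and $\eta=\mathbf H|_{T_eG\setminus\{0\}}:\mathfrak g\setminus\{0\}\to\mathfrak g$ is the spray vector field of $\mathbf G$. The connection operator is $$N(y,w)=\tfrac12 D\eta(y,w)-\tfrac12[y,w]_{\mathfrak g},\qquad y\in\mathfrak g\setminus\{0\},\ w\in\mathfrak g,$$ where $D\eta(y,w)$ is the derivative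 of $\eta$ at $y$ in the direction $w$. The Riemann curvature is $R_y(w)=R^i_k w^k\partial_{x^i}$ with $$R^i_k=2\frac{\partial \mathbf G^i}{\partial x^k}-y^j\frac{\partial^2\mathbf G^i}{\partial x^j\partial y^k}+2\mathbf G^j\frac{\partial^2\mathbf G^i}{\partial y^j\partial y^k}-\frac{\partial\mathbf G^i}{\partial y^j}\frac{\partial\mathbf G^j}{\partial y^k}.$$ For a smooth vector field $Y(t)\in\mathfrak g$ along an integral curve $y(t)$ of $-\eta$, the bracket $[\eta,Y(t)]$ is defined as $-[-\eta,Y(t)]$, where $$[-\eta,Y(t)]=\tfrac{\mathrm d}{\mathrm dt}Y(t)+D\eta(y(t),Y(t))$$ is the Lie derivative of $Y(t)$ along the integral curve $y(t)$ of $-\eta$. **Theorem 1.2.** Let $c(t)$, $t$ in an open interval, be a geodesic of $\mathbf G$, i.e. a smooth curve with nowhere vanishing $\dot c(t)$ such that $(c(t),\dot c(t))$ is an integral curve of $\mathbf G$. Let $W(t)=z^i(t)\partial_{x^i}|_{c(t)}$ be a smooth vector field along $c(t)$ that is linearly parallel, i.e. $\tfrac{\mathrm d z^i}{\mathrm dt}+z^jN^i_j(c(t),\dot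 c(t))=0$ for all $t$. Put $y(t)=(L_{c(t)^{-1}})_*\dot c(t)$ and $w(t)=(L_{c(t)^{-1}})_*W(t)$. Then $y(t)$ is a smooth curve in $\mathfrak g\setminus\{0\}$, $\eta$ is differentiable at its points, and $y(t)$ is an integral curve of $-\eta$; moreover $w(t)$, $N(t)=N(y(t),w(t))$ and $R(t)=R_{y(t)}(w(t))$ are smooth vector fields along $y(t)$, and for all $t$ $$N(t)=-[\eta,w(t)]\qquad\text{and}\qquad R(t)=[\eta,N(t)]=-[\eta,[\eta,w(t)]].$$ -/

import Mathlib

open Set Bundle Filter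
open scoped Manifold ContDiff Topology

noncomputable section

namespace SprayGeometry

/-! ### Standard local coordinates on the tangent bundle -/

section Coordinates

variable {E : Type*} [NormedAddCommGroup E] [NormedSpace ℝ E]
  {M : Type*} [TopologicalSpace M] [ChartedSpace E M]

/-- The components `yⁱ` of a tangent vector `v = yⁱ ∂_{xⁱ}` at `x` in the chart `e = (xⁱ)`. -/
def chartDeriv (e : OpenPartialHomeomorph M E) (x : M) : TangentSpace 𝓘(ℝ, E) x →L[ℝ] E :=
  mfderiv 𝓘(ℝ, E) 𝓘(ℝ, E) e x

/-- The tangent vector `yⁱ ∂_{xⁱ}` at the point `x` of the domain of the chart `e = (xⁱ)`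
(the inverse of `chartDeriv e x`). -/
def chartVector (e : OpenPartialHomeomorph M E) (x : M) (y : E) : TangentSpace 𝓘(ℝ, E) x :=
  (chartDeriv e x).inverse y

/-- The standard local coordinates `(xⁱ, yⁱ)` on `TM` induced by a chart `e = (xⁱ)` of `M`. -/
def stdCoord (e : OpenPartialHomeomorph M E) (p : TangentBundle 𝓘(ℝ, E) M) : E × E :=
  (e p.1, chartDeriv e p.1 p.2)

/-- The point of `TM` with given standard local coordinates. -/
def stdPoint (e : OpenPartialHomeomorph M E) (q : E × E) : TangentBundle 𝓘(ℝ, E) M :=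
  ⟨e.symm q.1, chartVector e (e.symm q.1) q.2⟩

variable [IsManifold 𝓘(ℝ, E) ∞ M]

/-- The differential of the standard local coordinates: it sends a tangent vector
`aⁱ ∂_{xⁱ} + bⁱ ∂_{yⁱ}` of `TM` at `p` to its components `(a, b)`. -/
def stdCoordDeriv (e : OpenPartialHomeomorph M E) (p : TangentBundle 𝓘(ℝ, E) M) :
    TangentSpace 𝓘(ℝ, E).tangent p →L[ℝ] E × E :=
  mfderiv 𝓘(ℝ, E).tangent 𝓘(ℝ, E × E) (stdCoord e) p

/-- The slit tangent bundle `TM \ 0`. -/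
def slit (E M : Type*) [NormedAddCommGroup E] [NormedSpace ℝ E] [TopologicalSpace M]
    [ChartedSpace E M] : Set (TangentBundle 𝓘(ℝ, E) M) :=
  {p | p.2 ≠ 0}

/-- For a vector field `S` on `TM` whose representation in standard local coordinates is
`yⁱ ∂_{xⁱ} - 2 Gⁱ ∂_{yⁱ}`, this is the coefficient function `G = (Gⁱ)(x, y)`. -/
def sprayCoeff (S : ∀ p : TangentBundle 𝓘(ℝ, E) M, TangentSpace 𝓘(ℝ, E).tangent p)
    (e : OpenPartialHomeomorph M E) (x y : E) : E :=
  -(1 / 2 : ℝ) • (stdCoordDeriv e (stdPoint e (x, y)) (S (stdPoint e (x, y)))).2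

variable (E M) in
/-- A spray structure on `M`: a smooth vector field on the slit tangent bundle (its values on the
zero section are irrelevant) of the form `yⁱ ∂_{xⁱ} - 2 Gⁱ ∂_{yⁱ}` in all standard local
coordinates, with `Gⁱ(x, y)` positively homogeneous of degree two in `y`. -/
structure Spray where
  /-- The underlying vector field. -/
  field : ∀ p : TangentBundle 𝓘(ℝ, E) M, TangentSpace 𝓘(ℝ, E).tangent p
  smooth : ContMDiffOn 𝓘(ℝ, E).tangent 𝓘(ℝ, E).tangent.tangent ∞
    (fun p => (⟨p, field p⟩ : TangentBundle 𝓘(ℝ, E).tangent (TangentBundle 𝓘(ℝ, E) M)))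
    (slit E M)
  horizontal_part : ∀ e ∈ IsManifold.maximalAtlas 𝓘(ℝ, E) ∞ M, ∀ p ∈ slit E M, p.1 ∈ e.source →
    (stdCoordDeriv e p (field p)).1 = chartDeriv e p.1 p.2
  homogeneous : ∀ e ∈ IsManifold.maximalAtlas 𝓘(ℝ, E) ∞ M, ∀ x ∈ e.target, ∀ y : E, y ≠ 0 →
    ∀ r : ℝ, 0 < r → sprayCoeff field e x (r • y) = r ^ 2 • sprayCoeff field e x y

namespace Spray

variable (S : Spray E M)

/-- The coefficients `Gⁱ(x, y)` of a spray in standard local coordinates. -/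
def coeff (e : OpenPartialHomeomorph M E) (x y : E) : E := sprayCoeff S.field e x y

/-- `Nⁱ_j(x, y) vʲ`, where `Nⁱ_j = ∂Gⁱ/∂yʲ`. -/
def connCoeff (e : OpenPartialHomeomorph M E) (x y v : E) : E :=
  fderiv ℝ (fun y' => S.coeff e x y') y v

/-- The Riemann curvature in standard local coordinates,
`Rⁱ_k vᵏ` with
`Rⁱ_k = 2 ∂Gⁱ/∂xᵏ - yʲ ∂²Gⁱ/∂xʲ∂yᵏ + 2 Gʲ ∂²Gⁱ/∂yʲ∂yᵏ - ∂Gⁱ/∂yʲ ∂Gʲ/∂yᵏ`. -/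
def curvCoeff (e : OpenPartialHomeomorph M E) (x y v : E) : E :=
  (2 : ℝ) • fderiv ℝ (fun x' => S.coeff e x' y) x v
    - fderiv ℝ (fun x' => S.connCoeff e x' y v) x y
    + (2 : ℝ) • fderiv ℝ (fun y' => S.connCoeff e x y' v) y (S.coeff e x y)
    - S.connCoeff e x y (S.connCoeff e x y v)

/-- The Riemann curvature `R_y(w) = Rⁱ_k(x, y) wᵏ ∂_{xⁱ}` of a spray, for `y, w ∈ T_x M`, `y ≠ 0`.
It is computed in the preferred chart at `x` (the result does not depend on the chart). -/
def riemannCurvature (x : M) (y w : TangentSpace 𝓘(ℝ, E) x) : TangentSpace 𝓘(ℝ, E) x :=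
  chartVector (chartAt E x) x
    (S.curvCoeff (chartAt E x) (chartAt E x x) (chartDeriv (chartAt E x) x y)
      (chartDeriv (chartAt E x) x w))

end Spray

/-- The velocity `ċ(t)` of a curve. -/
def velocity (c : ℝ → M) (t : ℝ) : TangentSpace 𝓘(ℝ, E) (c t) :=
  mfderiv 𝓘(ℝ, ℝ) 𝓘(ℝ, E) c t (1 : ℝ)

namespace Spray

variable (S : Spray E M)

/-- A smooth curve `c`, defined on the open set `J ⊆ ℝ`, with nowhere vanishing velocity is a
geodesic if its lift `(c, ċ)` is an integral curve of the spray. -/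
structure IsGeodesicOn (c : ℝ → M) (J : Set ℝ) : Prop where
  smooth : ContMDiffOn 𝓘(ℝ, ℝ) 𝓘(ℝ, E) ∞ c J
  velocity_ne_zero : ∀ t ∈ J, velocity (E := E) c t ≠ 0
  integralCurve : IsMIntegralCurveOn (I := 𝓘(ℝ, E).tangent)
    (fun t => (⟨c t, velocity c t⟩ : TangentBundle 𝓘(ℝ, E) M)) S.field J

/-- The linearly covariant derivative
`D_ċ W = (dzⁱ/dt + zʲ Nⁱ_j(c, ċ)) ∂_{xⁱ}` of a vector field `W = zⁱ ∂_{xⁱ}` along a curve `c`.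
At time `t` it is computed in the preferred chart at `c t`
(the result does not depend on the chart). -/
def covDeriv (c : ℝ → M) (W : ∀ t, TangentSpace 𝓘(ℝ, E) (c t)) (t : ℝ) :
    TangentSpace 𝓘(ℝ, E) (c t) :=
  chartVector (chartAt E (c t)) (c t)
    (deriv (fun s => chartDeriv (chartAt E (c t)) (c s) (W s)) t
      + S.connCoeff (chartAt E (c t)) (chartAt E (c t) (c t))
          (chartDeriv (chartAt E (c t)) (c t) (velocity c t))
          (chartDeriv (chartAt E (c t)) (c t) (W t)))

/-- `W` is a linearly parallel smooth vector field along the curve `c` on the open set `J`. -/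
structure IsLinearlyParallelOn (c : ℝ → M) (W : ∀ t, TangentSpace 𝓘(ℝ, E) (c t)) (J : Set ℝ) :
    Prop where
  smooth : ContMDiffOn 𝓘(ℝ, ℝ) 𝓘(ℝ, E).tangent ∞
    (fun t => (⟨c t, W t⟩ : TangentBundle 𝓘(ℝ, E) M)) J
  covDeriv_eq_zero : ∀ t ∈ J, S.covDeriv c W t = 0

end Spray

/-- The complete lift `Xⁱ ∂_{xⁱ} + yʲ (∂Xⁱ/∂xʲ) ∂_{yⁱ}` to `TM` of a vector field `X = Xⁱ ∂_{xⁱ}`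
on `M`. At `p ∈ T_x M` it is computed in the preferred chart at `x`
(the result does not depend on the chart). -/
def completeLift (X : ∀ x : M, TangentSpace 𝓘(ℝ, E) x) (p : TangentBundle 𝓘(ℝ, E) M) :
    TangentSpace 𝓘(ℝ, E).tangent p :=
  let e := chartAt E p.1
  let Xe : E → E := fun x' => chartDeriv e (e.symm x') (X (e.symm x'))
  (stdCoordDeriv e p).inverse (Xe (e p.1), fderiv ℝ Xe (e p.1) (chartDeriv e p.1 p.2))

end Coordinates

/-! ### Left invariant sprays on Lie groups -/

section LieGroup

variable {E : Type*} [NormedAddCommGroup E] [NormedSpace ℝ E]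
  {G : Type*} [TopologicalSpace G] [ChartedSpace E G] [Group G]

/-- The left translation `(L_{g⁻¹})_* : T_g G → T_e G = 𝔤`. -/
def leftTriv (g : G) (v : TangentSpace 𝓘(ℝ, E) g) : GroupLieAlgebra 𝓘(ℝ, E) G :=
  mfderiv 𝓘(ℝ, E) 𝓘(ℝ, E) (fun x : G => g⁻¹ * x) g v

variable [LieGroup 𝓘(ℝ, E) ∞ G]

/-- The canonical bi-invariant spray `𝐆₀ = uⁱ Ũ_i` as a vector field on `TG`, where `Ũ_i` is the
complete lift of the left invariant vector field `U_i` that extends the basis vector `e_i` of `𝔤`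
and `uⁱ` are the corresponding fibre coordinates. Since complete lifts are linear over constants,
its value at `p = uⁱ U_i(g)` is that of the complete lift of the left invariant vector field
extending `uⁱ e_i = (L_{g⁻¹})_* p`, the `uⁱ` being frozen. -/
def canonicalField (p : TangentBundle 𝓘(ℝ, E) G) : TangentSpace 𝓘(ℝ, E).tangent p :=
  completeLift (mulInvariantVectorField (leftTriv p.1 p.2)) p

namespace Spray

variable (S : Spray E G)

/-- A spray on a Lie group is left invariant if all left translations (acting on `TG` by their
tangent maps) preserve it. -/
def IsLeftInvariant : Prop :=
  ∀ g : G, ∀ p ∈ slit E G,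
    mfderiv 𝓘(ℝ, E).tangent 𝓘(ℝ, E).tangent
      (tangentMap 𝓘(ℝ, E) 𝓘(ℝ, E) (fun x : G => g * x)) p (S.field p)
    = S.field (tangentMap 𝓘(ℝ, E) 𝓘(ℝ, E) (fun x : G => g * x) p)

/-- The vector field `𝐇 = 𝐆₀ - 𝐆` on `TG \ 0`, tangent to the fibres. -/
def verticalField (p : TangentBundle 𝓘(ℝ, E) G) : TangentSpace 𝓘(ℝ, E).tangent p :=
  canonicalField p - S.field p

/-- The spray vector field `η = 𝐇|_{T_e G \ {0}}`, as a map `𝔤 \ {0} → 𝔤`: the vertical vector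
`𝐇(e, y) = ηⁱ ∂_{yⁱ}` is identified with `ηⁱ ∂_{xⁱ} ∈ T_e G`. -/
def eta (y : GroupLieAlgebra 𝓘(ℝ, E) G) : GroupLieAlgebra 𝓘(ℝ, E) G :=
  chartVector (chartAt E (1 : G)) 1
    (stdCoordDeriv (chartAt E (1 : G)) ⟨1, y⟩ (S.verticalField ⟨1, y⟩)).2

/-- The connection operator `N(y, w) = ½ Dη(y, w) - ½ [y, w]_𝔤`. -/
def connOp (y w : GroupLieAlgebra 𝓘(ℝ, E) G) : GroupLieAlgebra 𝓘(ℝ, E) G :=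
  (1 / 2 : ℝ) • fderiv ℝ S.eta y w - (1 / 2 : ℝ) • ⁅y, w⁆

end Spray

/-- Smoothness on `J` of a curve in the (finite-dimensional) vector space `𝔤 = T_e G`, which is
modelled on `E`. -/
def SmoothOn (f : ℝ → GroupLieAlgebra 𝓘(ℝ, E) G) (J : Set ℝ) : Prop :=
  ContDiffOn ℝ ∞ (F := E) f J

end LieGroup

/-! ### Brackets along integral curves -/

section Bracket

variable {V : Type*} [AddCommGroup V] [Module ℝ V] [TopologicalSpace V]

/-- The bracket `[X, Y(t)] = (dYⁱ/dt - Yʲ ∂Xⁱ/∂xʲ) ∂_{xⁱ}` of a vector field `X` on (an open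
subset of) a vector space with a vector field `Y(t)` along an integral curve `γ` of `X`, i.e. the
Lie derivative of `Y(t)` along `γ`. -/
def lieDerivAlong (X : V → V) (γ : ℝ → V) (Y : ℝ → V) (t : ℝ) : V :=
  deriv Y t - fderiv ℝ X (γ t) (Y t)

/-- For a vector field `Y(t)` along an integral curve `γ` of `-η`, the bracket
`[η, Y(t)] = -[-η, Y(t)]`. -/
def bracketAlong (η : V → V) (γ : ℝ → V) (Y : ℝ → V) (t : ℝ) : V :=
  -lieDerivAlong (fun v => -η v) γ Y t

end Bracket

/-- If `Y(t)` is the restriction to `γ` of a vector field `Z`, then `[X, Y(t)]` is the restriction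
of the usual Lie bracket `[X, Z]`. -/
theorem lieDerivAlong_eq_lieBracket {V : Type*} [NormedAddCommGroup V] [NormedSpace ℝ V]
    {X Z : V → V} {γ Y : ℝ → V} {t : ℝ} (hγ : HasDerivAt γ (X (γ t)) t)
    (hZ : DifferentiableAt ℝ Z (γ t)) (hY : Y =ᶠ[𝓝 t] fun s => Z (γ s)) :
    lieDerivAlong X γ Y t = VectorField.lieBracket ℝ X Z (γ t) := by
  have h := hZ.hasFDerivAt.comp_hasDerivAt t hγ
  rw [lieDerivAlong, hY.deriv_eq, VectorField.lieBracket, hY.eq_of_nhds]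
  rw [show deriv (fun s => Z (γ s)) t = fderiv ℝ Z (γ t) (X (γ t)) from h.deriv]

end SprayGeometry

end

open SprayGeometry

/-!
The left invariant vector fields trivialize the tangent bundle. In a chart with coordinate `x` let
`A x : 𝔤 → E` be the linear map sending `u` to the components of the left invariant field of `u`
(`leftFrame`), so that a point of `TG` has coordinates `(x, A x u)`. Two facts describe the
geometry in these terms.

* The bracket of left invariant fields gives `DA(A u) v - DA(A v) u = A [u, v]`
  (`isInvariantFrame_leftFrame`).
* The map `leftForm : TG → 𝔤`, `p ↦ (L_{g⁻¹})_* p`, is invariant under left translations, so its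
  derivative along a left invariant spray depends only on the value of `leftForm`. This value is
  `-η`, because the derivative of `leftForm` along the canonical spray vanishes
  (`Spray.eta_eq_neg_drift`). In coordinates, `2 G(x, A u) = A η(u) - DA(A u) u`
  (`Spray.isFrameSpray`).

The second fact, applied to the curve `(c, ċ)`, says that `y' = -η(y)`. Differentiating the formula
for `G` in the fibre gives `N(x, A u)(A v) = A M(u, v) - DA(A u) v` with
`M(u, v) = ½ (Dη(u) v + [u, v])` (`IsFrameSpray.conn_eq`), so that a vector field `A w` along `c` is
linearly parallel exactly if `w' = -M(y, w)` (`Spray.hasDerivAt_leftForm_of_parallel`); this is the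
formula for `N(t)`. Inserting both formulas into the coordinate expression of the Riemann curvature,
all first and second derivatives of `A` cancel by the bracket identity and its derivative along
`A u`, and
`R_u(v) = ½ (D²η(u)(η(u), v) - [η(u), v]) + Dη(u) [u, v] - M(u, M(u, v))`
remains (`IsFrameSpray.curv_eq`). Along the integral curve `y` this expression is
`-(N' + Dη(y) N) = [η, N]` (`hasDerivAt_frameConnOp`).
-/

noncomputable section

namespace SprayGeometry

/-! ### Sprays in an invariant frame of a normed space -/

section InvariantFrame

variable {E : Type*} [NormedAddCommGroup E] [NormedSpace ℝ E]
  {A : E → E →L[ℝ] E} {br : E →L[ℝ] E →L[ℝ] E} {U : Set E} {η : E → E} {Γ : E → E → E}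
  {x u : E} {y w : ℝ → E} {J : Set ℝ} {t : ℝ}

/-- A smooth frame `x ↦ A x` on an open set `U`, seen as a family of linear isomorphisms from the
space of frame coefficients to the tangent spaces, such that the vector fields `x ↦ A x u` form
a Lie algebra with constant structure `br`: the Lie bracket of `A u` and `A v` is `A (br u v)`. -/
structure IsInvariantFrame (A : E → E →L[ℝ] E) (br : E →L[ℝ] E →L[ℝ] E) (U : Set E) : Prop where
  isOpen : IsOpen U
  contDiffOn : ContDiffOn ℝ ∞ A U
  isInvertible : ∀ x ∈ U, (A x).IsInvertible
  bracket : ∀ x ∈ U, ∀ u v,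
    fderiv ℝ A x (A x u) v - fderiv ℝ A x (A x v) u = A x (br u v)

namespace IsInvariantFrame

lemma hasFDerivAt (h : IsInvariantFrame A br U) (hx : x ∈ U) :
    HasFDerivAt A (fderiv ℝ A x) x :=
  ((h.contDiffOn.contDiffAt (h.isOpen.mem_nhds hx)).differentiableAt (by simp)).hasFDerivAt

lemma hasFDerivAt_fderiv (h : IsInvariantFrame A br U) (hx : x ∈ U) :
    HasFDerivAt (fderiv ℝ A) (fderiv ℝ (fderiv ℝ A) x) x :=
  (((h.contDiffOn.contDiffAt (h.isOpen.mem_nhds hx)).fderiv_right (m := 1)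
    (by norm_cast)).differentiableAt (by simp)).hasFDerivAt

lemma fderiv_fderiv_comm (h : IsInvariantFrame A br U) (hx : x ∈ U) (a b : E) :
    fderiv ℝ (fderiv ℝ A) x a b = fderiv ℝ (fderiv ℝ A) x b a :=
  ((h.contDiffOn.contDiffAt (h.isOpen.mem_nhds hx)).isSymmSndFDerivAt
    (by rw [minSmoothness_of_isRCLikeNormedField]; exact WithTop.coe_le_coe.2 le_top)).eq a b

lemma inverse_apply (h : IsInvariantFrame A br U) (hx : x ∈ U) (u : E) :
    (A x).inverse (A x u) = u :=
  (h.isInvertible x hx).inverse_apply_self u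

lemma apply_inverse (h : IsInvariantFrame A br U) (hx : x ∈ U) (y : E) :
    A x ((A x).inverse y) = y :=
  (h.isInvertible x hx).self_apply_inverse y

lemma injective (h : IsInvariantFrame A br U) (hx : x ∈ U) : Function.Injective (A x) :=
  Function.LeftInverse.injective (h.inverse_apply hx)

lemma contDiffAt_inverse [CompleteSpace E] (h : IsInvariantFrame A br U) (hx : x ∈ U) :
    ContDiffAt ℝ ∞ (fun x' => (A x').inverse) x := by
  obtain ⟨e, he⟩ := h.isInvertible x hx
  have := contDiffAt_map_inverse (n := ∞) (𝕜 := ℝ) e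
  rw [he] at this
  exact this.comp x (h.contDiffOn.contDiffAt (h.isOpen.mem_nhds hx))

lemma hasFDerivAt_inverse_apply [CompleteSpace E] (h : IsInvariantFrame A br U) (hx : x ∈ U)
    (y : E) : ∃ b : E →L[ℝ] E, HasFDerivAt (fun x' => (A x').inverse y) b x ∧
      ∀ a, A x (b a) = -fderiv ℝ A x a ((A x).inverse y) := by
  have hd : DifferentiableAt ℝ (fun x' => (A x').inverse y) x :=
    ((h.contDiffAt_inverse hx).differentiableAt (by simp)).clm_apply (differentiableAt_const y)
  refine ⟨_, hd.hasFDerivAt, fun a => ?_⟩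
  have h1 := (h.hasFDerivAt hx).clm_apply hd.hasFDerivAt
  have h2 : HasFDerivAt (fun x' => A x' ((A x').inverse y)) (0 : E →L[ℝ] E) x := by
    refine (hasFDerivAt_const y x).congr_of_eventuallyEq ?_
    filter_upwards [h.isOpen.mem_nhds hx] with x' hx' using h.apply_inverse hx' y
  have := congr($(h1.unique h2) a)
  simpa [eq_neg_iff_add_eq_zero] using this

lemma contDiffAt_coframe [CompleteSpace E] (h : IsInvariantFrame A br U) (hx : x ∈ U) (y : E) :
    ContDiffAt ℝ ∞ (fun q : E × E => (A q.1).inverse q.2) (x, y) :=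
  ((h.contDiffAt_inverse hx).comp (x, y) contDiffAt_fst).clm_apply contDiffAt_snd

lemma apply_fderiv_coframe [CompleteSpace E] (h : IsInvariantFrame A br U) (hx : x ∈ U)
    (y a b : E) :
    A x (fderiv ℝ (fun q : E × E => (A q.1).inverse q.2) (x, y) (a, b))
      = b - fderiv ℝ A x a ((A x).inverse y) := by
  have hd := ((h.contDiffAt_coframe hx y).differentiableAt (by simp)).hasFDerivAt
  have hA : HasFDerivAt (fun q : E × E => A q.1)
      ((fderiv ℝ A x).comp (ContinuousLinearMap.fst ℝ E E)) (x, y) :=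
    (h.hasFDerivAt hx).comp (x, y) hasFDerivAt_fst
  have h1 := hA.clm_apply hd
  have h2 : HasFDerivAt (fun q : E × E => A q.1 ((A q.1).inverse q.2))
      (ContinuousLinearMap.snd ℝ E E) (x, y) := by
    refine hasFDerivAt_snd.congr_of_eventuallyEq ?_
    filter_upwards [(h.isOpen.preimage continuous_fst).mem_nhds hx] with q hq
    exact h.apply_inverse hq q.2
  have := congr($(h1.unique h2) (a, b))
  simp only [add_apply, ContinuousLinearMap.coe_comp, Function.comp_apply,
    ContinuousLinearMap.flip_apply, ContinuousLinearMap.coe_fst', ContinuousLinearMap.coe_snd']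
    at this
  exact eq_sub_of_add_eq this

lemma hasDerivAt_apply (h : IsInvariantFrame A br U) {x : ℝ → E} {x' w' : E} (hx : x t ∈ U)
    (hxd : HasDerivAt x x' t) (hwd : HasDerivAt w w' t) :
    HasDerivAt (fun s => A (x s) (w s)) (fderiv ℝ A (x t) x' (w t) + A (x t) w') t :=
  ((h.hasFDerivAt hx).comp_hasDerivAt t hxd).clm_apply hwd

end IsInvariantFrame

/-- The coefficients `Γ x y` of a spray which in the frame `A` is given by the vector field
`A u ∂_x - η(u) ∂_u`. -/
structure IsFrameSpray (A : E → E →L[ℝ] E) (η : E → E) (Γ : E → E → E) (U : Set E) : Prop where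
  contDiffOn : ContDiffOn ℝ ∞ η {0}ᶜ
  coeff : ∀ x ∈ U, ∀ u ≠ 0, (2 : ℝ) • Γ x (A x u) = A x (η u) - fderiv ℝ A x (A x u) u

/-- The expression `M(u, v) = ½ (Dη(u) v + [u, v])`. A vector field with coefficients `w`
in the frame is parallel along a geodesic with velocity coefficients `u` if `w' = -M(u, w)`. -/
def frameConn (η : E → E) (br : E →L[ℝ] E →L[ℝ] E) (u v : E) : E :=
  (1 / 2 : ℝ) • (fderiv ℝ η u v + br u v)

/-- The Riemann curvature of a spray in terms of frame coefficients. -/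
def frameCurv (η : E → E) (br : E →L[ℝ] E →L[ℝ] E) (u v : E) : E :=
  (1 / 2 : ℝ) • (fderiv ℝ (fderiv ℝ η) u (η u) v - br (η u) v) + fderiv ℝ η u (br u v)
    - frameConn η br u (frameConn η br u v)

/-- The connection operator `N(u, v) = ½ Dη(u) v - ½ [u, v]`. -/
def frameConnOp (η : E → E) (br : E →L[ℝ] E →L[ℝ] E) (u v : E) : E :=
  (1 / 2 : ℝ) • fderiv ℝ η u v - (1 / 2 : ℝ) • br u v

namespace IsFrameSpray

lemma hasFDerivAt (hΓ : IsFrameSpray A η Γ U) (hu : u ≠ 0) : HasFDerivAt η (fderiv ℝ η u) u :=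
  ((hΓ.contDiffOn.contDiffAt (isOpen_compl_singleton.mem_nhds hu)).differentiableAt
    (by simp)).hasFDerivAt

lemma hasFDerivAt_fderiv (hΓ : IsFrameSpray A η Γ U) (hu : u ≠ 0) :
    HasFDerivAt (fderiv ℝ η) (fderiv ℝ (fderiv ℝ η) u) u :=
  (((hΓ.contDiffOn.contDiffAt (isOpen_compl_singleton.mem_nhds hu)).fderiv_right (m := 1)
    (by norm_cast)).differentiableAt (by simp)).hasFDerivAt

lemma coeff_eq (h : IsInvariantFrame A br U) (hΓ : IsFrameSpray A η Γ U) (hx : x ∈ U)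
    {y : E} (hy : y ≠ 0) :
    Γ x y = (1 / 2 : ℝ) •
      (A x (η ((A x).inverse y)) - fderiv ℝ A x y ((A x).inverse y)) := by
  have h0 : (A x).inverse y ≠ 0 := fun h0 => hy (by rw [← h.apply_inverse hx y, h0, map_zero])
  have := hΓ.coeff x hx _ h0
  rw [h.apply_inverse hx] at this
  rw [← this, smul_smul]; norm_num

/-- The bracket identity turns the symmetrized derivative of `A`, which arises from differentiating
`2 Γ x y = A η(A⁻¹ y) - DA(y) A⁻¹ y` in `y`, into `DA(A u) v`. -/
theorem conn_eq (h : IsInvariantFrame A br U) (hΓ : IsFrameSpray A η Γ U) (hx : x ∈ U)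
    (hu : u ≠ 0) (v : E) :
    fderiv ℝ (fun y' => Γ x y') (A x u) (A x v)
      = A x (frameConn η br u v) - fderiv ℝ A x (A x u) v := by
  have hy : A x u ≠ 0 := fun h0 => hu (h.injective hx (h0.trans (map_zero _).symm))
  have h1 : HasFDerivAt (fun y' => (A x).inverse y') (A x).inverse (A x u) :=
    (A x).inverse.hasFDerivAt
  have hη : HasFDerivAt η (fderiv ℝ η u) ((A x).inverse (A x u)) := by
    rw [h.inverse_apply hx]; exact hΓ.hasFDerivAt hu
  have h2 := (A x).hasFDerivAt.comp (A x u) (hη.comp (A x u) h1)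
  have h3 := (fderiv ℝ A x).hasFDerivAt (x := A x u) |>.clm_apply h1
  have h4 := (h2.sub h3).const_smul (1 / 2 : ℝ)
  have h5 := h4.congr_of_eventuallyEq (f₁ := fun y' => Γ x y') (by
    filter_upwards [isOpen_compl_singleton.mem_nhds hy] with y' hy'
    exact coeff_eq h hΓ hx hy')
  rw [h5.fderiv]
  have := h.bracket x hx u v
  simp only [one_div, FunLike.coe_smul, FunLike.coe_sub,
    ContinuousLinearMap.coe_comp, Pi.smul_apply, Pi.sub_apply, Function.comp_apply,
    h.inverse_apply hx, add_apply, ContinuousLinearMap.flip_apply,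
    frameConn, map_smul, map_add, ← this]
  module

lemma conn_eq' (h : IsInvariantFrame A br U) (hΓ : IsFrameSpray A η Γ U) (hx : x ∈ U)
    {y : E} (hy : y ≠ 0) (z : E) :
    fderiv ℝ (fun y' => Γ x y') y z
      = A x (frameConn η br ((A x).inverse y) ((A x).inverse z))
        - fderiv ℝ A x y ((A x).inverse z) := by
  have h0 : (A x).inverse y ≠ 0 := fun h0 => hy (by rw [← h.apply_inverse hx y, h0, map_zero])
  simpa only [h.apply_inverse hx] using conn_eq h hΓ hx h0 ((A x).inverse z)

set_option synthInstance.maxHeartbeats 200000 in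
set_option maxHeartbeats 1000000 in
/-- The left-hand side is `2 D_xΓ(z) - D_x(N z)(y) + 2 D_y(N z)(Γ) - N (N z)` with `y = A u` and
`z = A v`, the coordinate expression of the Riemann curvature. -/
theorem curv_eq [CompleteSpace E] (h : IsInvariantFrame A br U) (hΓ : IsFrameSpray A η Γ U)
    (hbr : ∀ a b, br a b = -br b a)
    (hx : x ∈ U) (hu : u ≠ 0) (v : E) :
    (2 : ℝ) • fderiv ℝ (fun x' => Γ x' (A x u)) x (A x v)
      - fderiv ℝ (fun x' => fderiv ℝ (fun y' => Γ x' y') (A x u) (A x v)) x (A x u)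
      + (2 : ℝ) • fderiv ℝ (fun y'' => fderiv ℝ (fun y' => Γ x y') y'' (A x v)) (A x u)
          (Γ x (A x u))
      - fderiv ℝ (fun y' => Γ x y') (A x u) (fderiv ℝ (fun y' => Γ x y') (A x u) (A x v))
      = A x (frameCurv η br u v) := by
  have hy : A x u ≠ 0 := fun h0 => hu (h.injective hx (h0.trans (map_zero _).symm))
  obtain ⟨bu, hbu, hbu'⟩ := h.hasFDerivAt_inverse_apply hx (A x u)
  obtain ⟨bv, hbv, hbv'⟩ := h.hasFDerivAt_inverse_apply hx (A x v)
  rw [h.inverse_apply hx] at hbu' hbv'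
  have hη : HasFDerivAt η (fderiv ℝ η u) ((A x).inverse (A x u)) := by
    rw [h.inverse_apply hx]; exact hΓ.hasFDerivAt hu
  have hη2 : HasFDerivAt (fderiv ℝ η) (fderiv ℝ (fderiv ℝ η) u) ((A x).inverse (A x u)) := by
    rw [h.inverse_apply hx]; exact hΓ.hasFDerivAt_fderiv hu
  have hU := h.isOpen.mem_nhds hx
  -- the derivative of the coefficients in the base point
  have hG := (((h.hasFDerivAt hx).clm_apply (hη.comp x hbu)).sub
    (((h.hasFDerivAt_fderiv hx).clm_apply (hasFDerivAt_const (A x u) x)).clm_apply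
      hbu)).const_smul (1 / 2 : ℝ)
  have hG' := hG.congr_of_eventuallyEq (f₁ := fun x' => Γ x' (A x u)) (by
    filter_upwards [hU] with x' hx' using coeff_eq h hΓ hx' hy)
  -- the derivative of the connection in the base point
  have hN := ((h.hasFDerivAt hx).clm_apply ((((hη2.comp x hbu).clm_apply hbv).add
    ((br.hasFDerivAt.comp x hbu).clm_apply hbv)).const_smul (1 / 2 : ℝ))).sub
    (((h.hasFDerivAt_fderiv hx).clm_apply (hasFDerivAt_const (A x u) x)).clm_apply hbv)
  have hN' := hN.congr_of_eventuallyEq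
    (f₁ := fun x' => fderiv ℝ (fun y' => Γ x' y') (A x u) (A x v)) (by
    filter_upwards [hU] with x' hx' using conn_eq' h hΓ hx' hy _)
  -- the derivative of the connection in the fibre
  have h1 : HasFDerivAt (fun y' => (A x).inverse y') (A x).inverse (A x u) :=
    (A x).inverse.hasFDerivAt
  have hF := ((A x).hasFDerivAt.comp (A x u)
      ((((hη2.comp (A x u) h1).clm_apply (hasFDerivAt_const v (A x u))).add
      ((br.hasFDerivAt.comp (A x u) h1).clm_apply
        (hasFDerivAt_const v (A x u)))).const_smul (1 / 2 : ℝ))).sub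
    ((fderiv ℝ A x).hasFDerivAt (x := A x u) |>.clm_apply (hasFDerivAt_const v (A x u)))
  have hF' := hF.congr_of_eventuallyEq
    (f₁ := fun y'' => fderiv ℝ (fun y' => Γ x y') y'' (A x v)) (by
    filter_upwards [isOpen_compl_singleton.mem_nhds hy] with y' hy'
    have := conn_eq' h hΓ hx hy' (A x v)
    rw [h.inverse_apply hx] at this
    exact this)
  -- the bracket identity, differentiated along `A x u`
  have hB1 := ((h.hasFDerivAt_fderiv hx).clm_apply ((h.hasFDerivAt hx).clm_apply
    (hasFDerivAt_const u x))).clm_apply (hasFDerivAt_const v x)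
  have hB2 := ((h.hasFDerivAt_fderiv hx).clm_apply ((h.hasFDerivAt hx).clm_apply
    (hasFDerivAt_const v x))).clm_apply (hasFDerivAt_const u x)
  have hB3 := (h.hasFDerivAt hx).clm_apply (hasFDerivAt_const (br u v) x)
  have hB := congr($((hB1.sub hB2).unique (hB3.congr_of_eventuallyEq (by
    filter_upwards [hU] with x' hx' using h.bracket x' hx' u v))) (A x u))
  -- frame coefficients of the derivatives of `A` that occur
  obtain ⟨q, hq⟩ : ∃ q, A x q = fderiv ℝ A x (A x u) v := ⟨_, h.apply_inverse hx _⟩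
  have hp : A x (q - br u v) = fderiv ℝ A x (A x v) u := by
    rw [map_sub, hq, ← h.bracket x hx u v]; abel
  have hbuv : bu (A x v) = -(q - br u v) := h.injective hx (by rw [hbu', map_neg, hp])
  have hbvu : bv (A x u) = -q := h.injective hx (by rw [hbv', map_neg, hq])
  obtain ⟨r, hr⟩ : ∃ r, A x r = fderiv ℝ A x (A x u) u := ⟨_, h.apply_inverse hx _⟩
  have hbuu : bu (A x u) = -r := h.injective hx (by rw [hbu', map_neg, hr])
  have hΓu : Γ x (A x u) = A x ((1 / 2 : ℝ) • (η u - r)) := by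
    rw [coeff_eq h hΓ hx hy, h.inverse_apply hx, map_smul, map_sub, hr]
  have hNv : fderiv ℝ (fun y' => Γ x y') (A x u) (A x v) = A x (frameConn η br u v - q) := by
    rw [conn_eq h hΓ hx hu, map_sub, hq]
  rw [hNv, conn_eq h hΓ hx hu, hG'.fderiv, hN'.fderiv, hF'.fderiv, hΓu]
  -- the terms with derivatives of `A` that are left over cancel by these three identities and `hB`
  have e1 := h.bracket x hx v (η u)
  rw [hbr v (η u)] at e1
  have e2 := h.bracket x hx u q
  have e3 := congr($(h.fderiv_fderiv_comm hx (A x u) (A x v)) u)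
  simp [h.inverse_apply hx, hbuv, hbvu, hbuu, ← hr, ← hq, -one_div] at hB ⊢
  simp only [frameCurv, frameConn, map_add, map_sub, map_smul, map_neg] at e1 ⊢
  linear_combination (norm := module) e1 + hB - e2 + e3

end IsFrameSpray

/-- Along an integral curve `y` of `-η` and a parallel field `w`, the Lie derivative of
`N(y, w)` along `y` is minus the curvature. -/
lemma hasDerivAt_frameConnOp
    (hη : HasFDerivAt (fderiv ℝ η) (fderiv ℝ (fderiv ℝ η) (y t)) (y t))
    (hy : HasDerivAt y (-η (y t)) t) (hw : HasDerivAt w (-frameConn η br (y t) (w t)) t) :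
    HasDerivAt (fun s => frameConnOp η br (y s) (w s))
      (-(frameCurv η br (y t) (w t) + fderiv ℝ η (y t) (frameConnOp η br (y t) (w t)))) t := by
  have h1 := ((hη.comp_hasDerivAt t hy).clm_apply hw).const_smul (1 / 2 : ℝ)
  have h2 := ((br.hasFDerivAt.comp_hasDerivAt t hy).clm_apply hw).const_smul (1 / 2 : ℝ)
  refine (h1.sub h2).congr_deriv ?_
  simp only [frameCurv, frameConn, frameConnOp, Function.comp_apply, map_neg, map_smul, map_add,
    map_sub, neg_apply]
  module

lemma contDiffOn_frameConnOp
    (hη : ContDiffOn ℝ ∞ η {0}ᶜ) (hy : ContDiffOn ℝ ∞ y J) (hw : ContDiffOn ℝ ∞ w J)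
    (hy0 : ∀ t ∈ J, y t ≠ 0) : ContDiffOn ℝ ∞ (fun t => frameConnOp η br (y t) (w t)) J := by
  have h1 : ContDiffOn ℝ ∞ (fderiv ℝ η) {0}ᶜ :=
    hη.fderiv_of_isOpen isOpen_compl_singleton le_rfl
  have h2 : ContDiffOn ℝ ∞ (fun t => fderiv ℝ η (y t)) J := h1.comp hy hy0
  have h3 : ContDiffOn ℝ ∞ (fun t => br (y t)) J := br.contDiff.comp_contDiffOn hy
  exact ((h2.clm_apply hw).const_smul _).sub ((h3.clm_apply hw).const_smul _)

/-- Integral curves of a smooth vector field are smooth. -/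
lemma contDiffOn_of_hasDerivAt {X : E → E} (hJ : IsOpen J)
    (hX : ContDiffOn ℝ ∞ X U) (hyU : ∀ t ∈ J, y t ∈ U)
    (hy : ∀ t ∈ J, HasDerivAt y (X (y t)) t) : ContDiffOn ℝ ∞ y J := by
  rw [contDiffOn_infty]
  intro n
  induction n with
  | zero => exact contDiffOn_zero.2 fun t ht => (hy t ht).continuousAt.continuousWithinAt
  | succ n ih =>
    refine (contDiffOn_succ_iff_deriv_of_isOpen (n := n) hJ).2 ⟨fun t ht =>
      (hy t ht).differentiableAt.differentiableWithinAt, by simp, ?_⟩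
    exact ((hX.of_le (by exact_mod_cast le_top)).comp ih hyU).congr fun t ht => (hy t ht).deriv

lemma bracketAlong_eq {w' : E} {L : E →L[ℝ] E} (hw : HasDerivAt w w' t)
    (hη : HasFDerivAt η L (y t)) : bracketAlong η y w t = -(w' + L (w t)) := by
  have h : fderiv ℝ (fun v => -η v) (y t) = -L := hη.neg.fderiv
  rw [bracketAlong, lieDerivAlong, h, hw.deriv, neg_apply, sub_neg_eq_add]

lemma bracketAlong_congr {w₁ : ℝ → E} (h : w =ᶠ[𝓝 t] w₁) :
    bracketAlong η y w t = bracketAlong η y w₁ t := by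
  rw [bracketAlong, bracketAlong, lieDerivAlong, lieDerivAlong, h.deriv_eq, h.eq_of_nhds]

/-- In frame coefficients, the formulas `N = -[η, w]` and `R = [η, N] = -[η, [η, w]]`. -/
theorem frameConnOp_frameCurv_eq_bracketAlong (hJ : IsOpen J)
    (hη : ContDiffOn ℝ ∞ η {0}ᶜ) (hy0 : ∀ t ∈ J, y t ≠ 0)
    (hy : ∀ t ∈ J, HasDerivAt y (-η (y t)) t)
    (hw : ∀ t ∈ J, HasDerivAt w (-frameConn η br (y t) (w t)) t) (ht : t ∈ J) :
    frameConnOp η br (y t) (w t) = -bracketAlong η y w t ∧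
    frameCurv η br (y t) (w t)
      = bracketAlong η y (fun s => frameConnOp η br (y s) (w s)) t ∧
    frameCurv η br (y t) (w t) = -bracketAlong η y (bracketAlong η y w) t := by
  have hC : ∀ u ≠ 0, ContDiffAt ℝ ∞ η u := fun u hu =>
    hη.contDiffAt (isOpen_compl_singleton.mem_nhds hu)
  have hd : ∀ u ≠ 0, HasFDerivAt η (fderiv ℝ η u) u := fun u hu =>
    ((hC u hu).differentiableAt (by simp)).hasFDerivAt
  have h1 : ∀ s ∈ J, bracketAlong η y w s = -frameConnOp η br (y s) (w s) := fun s hs => by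
    rw [bracketAlong_eq (hw s hs) (hd _ (hy0 s hs)), frameConnOp, frameConn]
    module
  have hN := hasDerivAt_frameConnOp (((hC _ (hy0 t ht)).fderiv_right (m := 1)
    (by norm_cast)).differentiableAt (by simp)).hasFDerivAt (hy t ht) (hw t ht)
  refine ⟨by rw [h1 t ht, neg_neg], ?_, ?_⟩
  · rw [bracketAlong_eq hN (hd _ (hy0 t ht))]
    module
  · have h2 : bracketAlong η y w =ᶠ[𝓝 t] fun s => -frameConnOp η br (y s) (w s) := by
      filter_upwards [hJ.mem_nhds ht] with s hs using h1 s hs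
    rw [bracketAlong_congr h2, bracketAlong_eq hN.fun_neg (hd _ (hy0 t ht)), map_neg]
    module

lemma contDiffOn_frameCurv (hη : ContDiffOn ℝ ∞ η {0}ᶜ)
    (hy : ContDiffOn ℝ ∞ y J) (hw : ContDiffOn ℝ ∞ w J)
    (hy0 : ∀ t ∈ J, y t ≠ 0) : ContDiffOn ℝ ∞ (fun t => frameCurv η br (y t) (w t)) J := by
  have h1 : ContDiffOn ℝ ∞ (fderiv ℝ η) {0}ᶜ :=
    hη.fderiv_of_isOpen isOpen_compl_singleton le_rfl
  have h2 : ContDiffOn ℝ ∞ (fderiv ℝ (fderiv ℝ η)) {0}ᶜ :=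
    h1.fderiv_of_isOpen isOpen_compl_singleton le_rfl
  have h3 : ContDiffOn ℝ ∞ (fun t => η (y t)) J := hη.comp hy hy0
  have h4 : ContDiffOn ℝ ∞ (fun t => fderiv ℝ η (y t)) J := h1.comp hy hy0
  have h5 : ContDiffOn ℝ ∞ (fun t => fderiv ℝ (fderiv ℝ η) (y t)) J := h2.comp hy hy0
  have h6 : ContDiffOn ℝ ∞ (fun t => br (y t)) J := br.contDiff.comp_contDiffOn hy
  have h7 : ContDiffOn ℝ ∞ (fun t => br (η (y t))) J := br.contDiff.comp_contDiffOn h3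
  have h8 : ∀ z : ℝ → E, ContDiffOn ℝ ∞ z J →
      ContDiffOn ℝ ∞ (fun t => frameConn η br (y t) (z t)) J := fun z hz =>
    ((h4.clm_apply hz).add (h6.clm_apply hz)).const_smul _
  exact ((((h5.clm_apply h3).clm_apply hw).sub (h7.clm_apply hw)).const_smul _).add
    (h4.clm_apply (h6.clm_apply hw)) |>.sub (h8 _ (h8 _ hw))

end InvariantFrame

/-! ### Standard coordinates of the preferred charts -/

section StandardCoordinates

variable {E : Type*} [NormedAddCommGroup E] [NormedSpace ℝ E]
  {M : Type*} [TopologicalSpace M] [ChartedSpace E M] [IsManifold 𝓘(ℝ, E) ∞ M]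

lemma chartDeriv_chartAt_eq_tangentCoordChange {g p : M} (hp : p ∈ (chartAt E g).source) :
    chartDeriv (chartAt E g) p = tangentCoordChange 𝓘(ℝ, E) p g p := by
  have : IsManifold 𝓘(ℝ, E) 1 M := .of_le (n := ∞) (by simp)
  exact mfderiv_chartAt_eq_tangentCoordChange hp

lemma isInvertible_chartDeriv {g p : M} (hp : p ∈ (chartAt E g).source) :
    (chartDeriv (chartAt E g) p).IsInvertible := by
  have : IsManifold 𝓘(ℝ, E) 1 M := .of_le (n := ∞) (by simp)
  exact isInvertible_mfderiv_extChartAt (I := 𝓘(ℝ, E)) (x := g) (y := p)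
    (by rwa [extChartAt_source])

lemma chartDeriv_chartVector {g p : M} (hp : p ∈ (chartAt E g).source) (y : E) :
    chartDeriv (chartAt E g) p (chartVector (chartAt E g) p y) = y :=
  (isInvertible_chartDeriv hp).self_apply_inverse y

lemma chartVector_chartDeriv {g p : M} (hp : p ∈ (chartAt E g).source)
    (y : TangentSpace 𝓘(ℝ, E) p) :
    chartVector (chartAt E g) p (chartDeriv (chartAt E g) p y) = y :=
  (isInvertible_chartDeriv hp).inverse_apply_self y

/-- The standard coordinates given by a preferred chart form a preferred chart of `TM`. -/
lemma stdCoord_eq_extChartAt {g : M} {p q : TangentBundle 𝓘(ℝ, E) M} (hq : q.1 = g)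
    (hp : p.1 ∈ (chartAt E g).source) :
    stdCoord (chartAt E g) p = extChartAt 𝓘(ℝ, E).tangent q p := by
  subst hq
  refine Prod.ext ?_ ?_
  · rfl
  · change chartDeriv (chartAt E q.1) p.1 p.2 = _
    rw [chartDeriv_chartAt_eq_tangentCoordChange hp]
    rfl

lemma isOpen_preimage_source (g : M) :
    IsOpen ((fun p : TangentBundle 𝓘(ℝ, E) M => p.1) ⁻¹' (chartAt E g).source) :=
  (chartAt E g).open_source.preimage (FiberBundle.continuous_proj E (TangentSpace 𝓘(ℝ, E)))

lemma stdCoord_eventuallyEq {g : M} {p q : TangentBundle 𝓘(ℝ, E) M} (hq : q.1 = g)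
    (hp : p.1 ∈ (chartAt E g).source) :
    stdCoord (chartAt E g) =ᶠ[𝓝 p] extChartAt 𝓘(ℝ, E).tangent q := by
  filter_upwards [(isOpen_preimage_source g).mem_nhds hp] with p' hp'
  exact stdCoord_eq_extChartAt hq hp'

lemma mem_extChartAt_tangent_source {g : M} {p q : TangentBundle 𝓘(ℝ, E) M} (hq : q.1 = g)
    (hp : p.1 ∈ (chartAt E g).source) : p ∈ (extChartAt 𝓘(ℝ, E).tangent q).source := by
  subst hq
  rw [extChartAt_source]
  exact (TangentBundle.mem_chart_source_iff (I := 𝓘(ℝ, E)) p q).2 hp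

lemma contMDiffAt_stdCoord {g : M} {p : TangentBundle 𝓘(ℝ, E) M}
    (hp : p.1 ∈ (chartAt E g).source) :
    ContMDiffAt 𝓘(ℝ, E).tangent 𝓘(ℝ, E × E) ∞ (stdCoord (chartAt E g)) p := by
  refine ContMDiffAt.congr_of_eventuallyEq ?_
    (stdCoord_eventuallyEq (q := (⟨g, 0⟩ : TangentBundle 𝓘(ℝ, E) M)) rfl hp)
  have := contMDiffAt_extChartAt' (I := 𝓘(ℝ, E).tangent) (n := ∞)
    (x := (⟨g, 0⟩ : TangentBundle 𝓘(ℝ, E) M)) (x' := p)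
    ((TangentBundle.mem_chart_source_iff (I := 𝓘(ℝ, E)) p _).2 hp)
  exact this

lemma isInvertible_stdCoordDeriv {g : M} {p : TangentBundle 𝓘(ℝ, E) M}
    (hp : p.1 ∈ (chartAt E g).source) :
    (stdCoordDeriv (chartAt E g) p).IsInvertible := by
  have h := (stdCoord_eventuallyEq (q := (⟨g, 0⟩ : TangentBundle 𝓘(ℝ, E) M)) rfl hp)
  have : IsManifold 𝓘(ℝ, E).tangent 1 (TangentBundle 𝓘(ℝ, E) M) := .of_le (n := ∞) (by simp)
  have := isInvertible_mfderiv_extChartAt (I := 𝓘(ℝ, E).tangent)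
    (mem_extChartAt_tangent_source (q := (⟨g, 0⟩ : TangentBundle 𝓘(ℝ, E) M)) rfl hp)
  rw [stdCoordDeriv]
  have h2 := h.mfderiv_eq (I := 𝓘(ℝ, E).tangent) (I' := 𝓘(ℝ, E × E))
  rw [h2]
  exact this

end StandardCoordinates

/-! ### The left invariant frame -/

section LeftInvariantFrame

variable {E : Type*} [NormedAddCommGroup E] [NormedSpace ℝ E]
  {G : Type*} [TopologicalSpace G] [ChartedSpace E G] [Group G]

lemma leftTriv_one (v : GroupLieAlgebra 𝓘(ℝ, E) G) : leftTriv (1 : G) v = v := by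
  rw [leftTriv]
  have : (fun x : G => (1 : G)⁻¹ * x) = id := by ext x; simp
  rw [this]
  exact congr($(mfderiv_id (I := 𝓘(ℝ, E)) (x := (1 : G))) v)

/-- The left invariant frame in the chart `e`: `leftFrame e x u` consists of the components, at the
point with coordinates `x`, of the left invariant vector field extending `u ∈ 𝔤`. -/
def leftFrame (e : OpenPartialHomeomorph G E) (x : E) : E →L[ℝ] E :=
  (chartDeriv e (e.symm x)).comp
    (mfderiv 𝓘(ℝ, E) 𝓘(ℝ, E) (fun h : G => e.symm x * h) (1 : G))

lemma leftFrame_apply (e : OpenPartialHomeomorph G E) (x : E) (u : GroupLieAlgebra 𝓘(ℝ, E) G) :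
    leftFrame e x u = chartDeriv e (e.symm x) (mulInvariantVectorField u (e.symm x)) := rfl

variable [LieGroup 𝓘(ℝ, E) ∞ G]

lemma mdifferentiableAt_mul_left (g h : G) :
    MDifferentiableAt 𝓘(ℝ, E) 𝓘(ℝ, E) (fun x : G => g * x) h :=
  (contMDiff_mul_left (I := 𝓘(ℝ, E)) (n := ∞)).contMDiffAt.mdifferentiableAt (by simp)

/-- The left trivialization is invariant under left translations. -/
lemma leftTriv_mfderiv_mul_left (g h : G) (v : TangentSpace 𝓘(ℝ, E) h) :
    leftTriv (g * h) (mfderiv 𝓘(ℝ, E) 𝓘(ℝ, E) (fun x : G => g * x) h v) = leftTriv h v := by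
  have := mfderiv_comp_apply (I := 𝓘(ℝ, E)) (I' := 𝓘(ℝ, E)) (I'' := 𝓘(ℝ, E)) h
    (mdifferentiableAt_mul_left (E := E) (g * h)⁻¹ (g * h))
    (mdifferentiableAt_mul_left (E := E) g h) v
  rw [leftTriv, leftTriv]
  have h2 : (fun x : G => (g * h)⁻¹ * x) ∘ (fun x : G => g * x) = fun x => h⁻¹ * x := by
    ext x; simp [mul_assoc]
  rw [h2] at this
  exact this.symm

lemma leftTriv_mulInvariantVectorField (g : G) (v : GroupLieAlgebra 𝓘(ℝ, E) G) :
    leftTriv g (mulInvariantVectorField v g) = v := by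
  have := mfderiv_comp_apply (I := 𝓘(ℝ, E)) (I' := 𝓘(ℝ, E)) (I'' := 𝓘(ℝ, E)) (1 : G)
    (mdifferentiableAt_mul_left (E := E) g⁻¹ (g * 1))
    (mdifferentiableAt_mul_left (E := E) g 1) v
  have h2 : (fun x : G => g⁻¹ * x) ∘ (fun x : G => g * x) = id := by
    ext x; simp
  rw [h2, mfderiv_id] at this
  rw [leftTriv, mulInvariantVectorField]
  rw [mul_one] at this
  exact this.symm

lemma mulInvariantVectorField_leftTriv (g : G) (v : TangentSpace 𝓘(ℝ, E) g) :
    mulInvariantVectorField (leftTriv g v) g = v := by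
  have := mfderiv_comp_apply (I := 𝓘(ℝ, E)) (I' := 𝓘(ℝ, E)) (I'' := 𝓘(ℝ, E)) g
    (mdifferentiableAt_mul_left (E := E) g (g⁻¹ * g))
    (mdifferentiableAt_mul_left (E := E) g⁻¹ g) v
  have h2 : (fun x : G => g * x) ∘ (fun x : G => g⁻¹ * x) = id := by
    ext x; simp
  rw [h2, mfderiv_id, inv_mul_cancel] at this
  exact this.symm

lemma leftFrame_leftTriv {g p : G} (hp : p ∈ (chartAt E g).source) (v : TangentSpace 𝓘(ℝ, E) p) :
    leftFrame (chartAt E g) (chartAt E g p) (leftTriv p v) = chartDeriv (chartAt E g) p v := by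
  rw [leftFrame_apply, (chartAt E g).left_inv hp, mulInvariantVectorField_leftTriv]

lemma leftFrame_one (v : E) : leftFrame (chartAt E (1 : G)) (chartAt E (1 : G) 1) v =
    chartDeriv (chartAt E (1 : G)) 1 v :=
  (congrArg (leftFrame (chartAt E (1 : G)) (chartAt E (1 : G) 1))
    (leftTriv_one (E := E) (G := G) v)).symm.trans (leftFrame_leftTriv (mem_chart_source E 1) v)

lemma isInvertible_mfderiv_mul_left (g : G) :
    (mfderiv 𝓘(ℝ, E) 𝓘(ℝ, E) (fun h : G => g * h) (1 : G)).IsInvertible := by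
  let f : E →L[ℝ] E := mfderiv 𝓘(ℝ, E) 𝓘(ℝ, E) (fun h : G => g * h) (1 : G)
  let f' : E →L[ℝ] E := mfderiv 𝓘(ℝ, E) 𝓘(ℝ, E) (fun h : G => g⁻¹ * h) g
  refine ContinuousLinearMap.IsInvertible.of_inverse (f := f) (g := f') ?_ ?_
  · ext v
    exact mulInvariantVectorField_leftTriv (E := E) g v
  · ext v
    exact leftTriv_mulInvariantVectorField (E := E) g v

lemma isInvertible_leftFrame {g : G} {x : E} (hx : x ∈ (chartAt E g).target) :
    (leftFrame (chartAt E g) x).IsInvertible :=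
  (isInvertible_chartDeriv ((chartAt E g).map_target hx)).comp
    (isInvertible_mfderiv_mul_left _)

lemma leftTriv_eq_inverse {g p : G} (hp : p ∈ (chartAt E g).source) (v : TangentSpace 𝓘(ℝ, E) p) :
    leftTriv p v =
      (leftFrame (chartAt E g) (chartAt E g p)).inverse (chartDeriv (chartAt E g) p v) := by
  rw [← leftFrame_leftTriv hp]
  exact ((isInvertible_leftFrame ((chartAt E g).map_source hp)).inverse_apply_self _).symm

/-- Mathlib's `contMDiff_mulInvariantVectorField` has this for a bounded order of smoothness. -/
lemma contMDiff_infty_mulInvariantVectorField (u : GroupLieAlgebra 𝓘(ℝ, E) G) :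
    ContMDiff 𝓘(ℝ, E) 𝓘(ℝ, E).tangent ∞
      (fun g : G => (⟨g, mulInvariantVectorField u g⟩ : TangentBundle 𝓘(ℝ, E) G)) := by
  intro g
  rw [contMDiffAt_section]
  have hmul : ContMDiffAt (𝓘(ℝ, E).prod 𝓘(ℝ, E)) 𝓘(ℝ, E) ∞
      (Function.uncurry fun a b : G => a * b) (g, (1 : G)) :=
    (contMDiff_mul 𝓘(ℝ, E) ∞).contMDiffAt
  have h := ContMDiffAt.mfderiv (I := 𝓘(ℝ, E)) (I' := 𝓘(ℝ, E)) (J := 𝓘(ℝ, E)) (m := ∞)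
    (fun a b : G => a * b) (fun _ => (1 : G)) hmul contMDiffAt_const le_rfl
  refine (h.clm_apply (contMDiffAt_const (M' := E) (c := u))).congr_of_eventuallyEq ?_
  filter_upwards [(chartAt E g).open_source.mem_nhds (mem_chart_source E g)] with p hp
  refine Eq.trans ?_ (congrArg (fun L : E →L[ℝ] E => L u)
    (inTangentCoordinates_eq (I := 𝓘(ℝ, E)) (I' := 𝓘(ℝ, E)) (fun _ => (1 : G)) (fun x : G => x * 1)
      (fun p : G => mfderiv 𝓘(ℝ, E) 𝓘(ℝ, E) (fun h : G => p * h) (1 : G))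
      (mem_chart_source E (1 : G)) (by simpa using hp))).symm
  have h1 : tangentCoordChange 𝓘(ℝ, E) (1 : G) 1 1 (u : E) = u :=
    tangentCoordChange_self (mem_extChartAt_source (1 : G))
  change _ = (tangentBundleCore 𝓘(ℝ, E) G).coordChange (achart E (p * 1)) (achart E (g * 1)) (p * 1)
    (mfderiv 𝓘(ℝ, E) 𝓘(ℝ, E) (fun h : G => p * h) (1 : G)
      (tangentCoordChange 𝓘(ℝ, E) (1 : G) 1 1 (u : E)))
  rw [h1, mul_one, mul_one]
  rfl

lemma contDiffOn_leftFrame [FiniteDimensional ℝ E] (g : G) :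
    ContDiffOn ℝ ∞ (leftFrame (chartAt E g)) (chartAt E g).target := by
  rw [contDiffOn_clm_apply]
  intro u x hx
  have hp := (chartAt E g).map_target hx
  have h1 := (contMDiffAt_stdCoord (p := ⟨(chartAt E g).symm x, mulInvariantVectorField
    (u : GroupLieAlgebra 𝓘(ℝ, E) G) ((chartAt E g).symm x)⟩) hp).comp ((chartAt E g).symm x)
    (contMDiff_infty_mulInvariantVectorField u).contMDiffAt
  have h2 : ContMDiffWithinAt 𝓘(ℝ, E) 𝓘(ℝ, E) ∞ (chartAt E g).symm (chartAt E g).target x :=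
    contMDiffOn_chart_symm (I := 𝓘(ℝ, E)) (n := ∞) x hx
  have h3 := h1.comp_contMDiffWithinAt x h2
  exact h3.contDiffWithinAt.snd

lemma mlieBracket_eq_lieBracket {F : Type*} [NormedAddCommGroup F] [NormedSpace ℝ F]
    (V W : ∀ x : F, TangentSpace 𝓘(ℝ, F) x) (x : F) :
    VectorField.mlieBracket 𝓘(ℝ, F) V W x = VectorField.lieBracket ℝ V W x := by
  have h := VectorField.mlieBracketWithin_eq_lieBracketWithin (𝕜 := ℝ) (V := V) (W := W)
    (s := univ)
  rw [VectorField.mlieBracketWithin_univ] at h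
  exact congrFun (h.trans (VectorField.lieBracketWithin_univ (V := V) (W := W))) x

lemma lieBracket_leftFrame [FiniteDimensional ℝ E] (g : G) {x : E} (hx : x ∈ (chartAt E g).target)
    (u v : GroupLieAlgebra 𝓘(ℝ, E) G) :
    VectorField.lieBracket ℝ (fun x' => leftFrame (chartAt E g) x' u)
      (fun x' => leftFrame (chartAt E g) x' v) x =
        leftFrame (chartAt E g) x (⁅u, v⁆ : GroupLieAlgebra 𝓘(ℝ, E) G) := by
  have : LieGroup 𝓘(ℝ, E) (minSmoothness ℝ 3) G := .of_le (n := ∞) (by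
    rw [minSmoothness_of_isRCLikeNormedField]; exact ENat.LEInfty.out)
  have h2 : ContMDiffAt 𝓘(ℝ, E) 𝓘(ℝ, E) ∞ (chartAt E g).symm x :=
    (contMDiffOn_chart_symm (I := 𝓘(ℝ, E)) (n := ∞) x hx).contMDiffAt
      ((chartAt E g).open_target.mem_nhds hx)
  have h3 := VectorField.mpullback_mlieBracket (I := 𝓘(ℝ, E)) (I' := 𝓘(ℝ, E)) (n := ∞)
    (V := mulInvariantVectorField u) (W := mulInvariantVectorField v)
    (mdifferentiableAt_mulInvariantVectorField u (g := (chartAt E g).symm x))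
    (mdifferentiableAt_mulInvariantVectorField v) h2
    (by rw [minSmoothness_of_isRCLikeNormedField]; exact ENat.LEInfty.out)
  have hpb : ∀ w : GroupLieAlgebra 𝓘(ℝ, E) G, ∀ x' ∈ (chartAt E g).target,
      VectorField.mpullback 𝓘(ℝ, E) 𝓘(ℝ, E) (chartAt E g).symm (mulInvariantVectorField w) x'
        = leftFrame (chartAt E g) x' w := by
    intro w x' hx'
    -- a pullback by `e.symm` is a pushforward by `e`
    have he := mdifferentiable_chart (I := 𝓘(ℝ, E)) g
    have h1 := he.comp_symm_deriv hx'
    have h2 := he.symm_comp_deriv ((chartAt E g).map_target hx')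
    rw [(chartAt E g).right_inv hx'] at h2
    let f : E →L[ℝ] E := mfderiv 𝓘(ℝ, E) 𝓘(ℝ, E) (chartAt E g).symm x'
    let f' : E →L[ℝ] E := mfderiv 𝓘(ℝ, E) 𝓘(ℝ, E) (chartAt E g) ((chartAt E g).symm x')
    have h4 : f.inverse = f' := ContinuousLinearMap.inverse_eq h2 h1
    exact congrArg (fun L : E →L[ℝ] E => L (mulInvariantVectorField w ((chartAt E g).symm x'))) h4
  rw [← mulInvariantVector_mlieBracket, hpb _ x hx] at h3
  rw [GroupLieAlgebra.bracket_def, h3]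
  refine Eq.trans (mlieBracket_eq_lieBracket _ _ x).symm ?_
  symm
  refine Filter.EventuallyEq.mlieBracket_vectorField_eq ?_ ?_ <;>
  filter_upwards [(chartAt E g).open_target.mem_nhds hx] with x' hx' using hpb _ x' hx'

variable (E G) in
/-- The Lie bracket of `𝔤` as a continuous bilinear map on the model space `E`, with which
`𝔤 = T_e G` is identified definitionally. -/
def lieBracketCLM [FiniteDimensional ℝ E] : E →L[ℝ] E →L[ℝ] E :=
  haveI : LieGroup 𝓘(ℝ, E) (minSmoothness ℝ 3) G := .of_le (n := ∞) (by
    rw [minSmoothness_of_isRCLikeNormedField]; exact ENat.LEInfty.out)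
  LinearMap.toContinuousBilinearMap (LinearMap.mk₂ ℝ
    (fun u v : E => Bracket.bracket (L := GroupLieAlgebra 𝓘(ℝ, E) G)
      (M := GroupLieAlgebra 𝓘(ℝ, E) G) u v)
    (fun u u' v => add_lie (M := GroupLieAlgebra 𝓘(ℝ, E) G) (L := GroupLieAlgebra 𝓘(ℝ, E) G) u u' v)
    (fun r u v => smul_lie (M := GroupLieAlgebra 𝓘(ℝ, E) G) (L := GroupLieAlgebra 𝓘(ℝ, E) G) r u v)
    (fun u v v' => lie_add (M := GroupLieAlgebra 𝓘(ℝ, E) G) (L := GroupLieAlgebra 𝓘(ℝ, E) G) u v v')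
    (fun r u v => lie_smul (M := GroupLieAlgebra 𝓘(ℝ, E) G) (L := GroupLieAlgebra 𝓘(ℝ, E) G) r u v))

lemma lieBracketCLM_swap [FiniteDimensional ℝ E] (u v : E) :
    lieBracketCLM E G u v = -lieBracketCLM E G v u := by
  have : LieGroup 𝓘(ℝ, E) (minSmoothness ℝ 3) G := .of_le (n := ∞) (by
    rw [minSmoothness_of_isRCLikeNormedField]; exact ENat.LEInfty.out)
  exact (lie_skew (L := GroupLieAlgebra 𝓘(ℝ, E) G) u v).symm

theorem isInvariantFrame_leftFrame [FiniteDimensional ℝ E] (g : G) :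
    IsInvariantFrame (leftFrame (chartAt E g)) (lieBracketCLM E G) (chartAt E g).target where
  isOpen := (chartAt E g).open_target
  contDiffOn := contDiffOn_leftFrame g
  isInvertible _ hx := isInvertible_leftFrame hx
  bracket x hx u v := by
    have h := lieBracket_leftFrame g hx u v
    have hA := (((contDiffOn_leftFrame g).contDiffAt
      ((chartAt E g).open_target.mem_nhds hx)).differentiableAt (by simp)).hasFDerivAt
    have hd : ∀ w : E, fderiv ℝ (fun x' => leftFrame (chartAt E g) x' w) x
        = (fderiv ℝ (leftFrame (chartAt E g)) x).flip w := fun w => by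
      rw [(hA.clm_apply (hasFDerivAt_const w x)).fderiv]; simp
    rw [VectorField.lieBracket, hd, hd] at h
    exact h

end LeftInvariantFrame

/-! ### The left trivialization of the tangent bundle -/

section LeftForm

variable {E : Type*} [NormedAddCommGroup E] [NormedSpace ℝ E]
  {G : Type*} [TopologicalSpace G] [ChartedSpace E G] [Group G]

/-- The left trivialization `TG → 𝔤` (the left Maurer–Cartan form) as a function on `TG` with
values in the model space. -/
def leftForm (p : TangentBundle 𝓘(ℝ, E) G) : E := leftTriv p.1 p.2

variable (G) in
/-- The vector `u ∈ 𝔤`, as a point of `TG` over the identity. -/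
def tangentOne (u : E) : TangentBundle 𝓘(ℝ, E) G := ⟨1, u⟩

lemma tangentMap_inv_mul_left (p : TangentBundle 𝓘(ℝ, E) G) :
    tangentMap 𝓘(ℝ, E) 𝓘(ℝ, E) (fun x : G => p.1⁻¹ * x) p
      = tangentOne G (leftForm p) :=
  TotalSpace.ext (inv_mul_cancel p.1) (heq_of_eq rfl)

lemma leftForm_one (u : E) : leftForm (tangentOne G u) = u :=
  leftTriv_one (E := E) (G := G) u

lemma tangentOne_mem_slit {u : E} (hu : u ≠ 0) : tangentOne G u ∈ slit E G := hu

variable [LieGroup 𝓘(ℝ, E) ∞ G]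

/-- The derivative of `leftForm` at `p` in the direction `V`. -/
def leftFormDeriv (p : TangentBundle 𝓘(ℝ, E) G) (V : TangentSpace 𝓘(ℝ, E).tangent p) : E :=
  mfderiv 𝓘(ℝ, E).tangent 𝓘(ℝ, E) (leftForm : TangentBundle 𝓘(ℝ, E) G → E) p V

lemma leftForm_eventuallyEq {g : G} {p : TangentBundle 𝓘(ℝ, E) G}
    (hp : p.1 ∈ (chartAt E g).source) :
    leftForm =ᶠ[𝓝 p] (fun q : E × E => (leftFrame (chartAt E g) q.1).inverse q.2) ∘
      stdCoord (chartAt E g) := by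
  filter_upwards [(isOpen_preimage_source g).mem_nhds hp] with p' hp'
  exact leftTriv_eq_inverse hp' p'.2

lemma leftForm_tangentMap_mul_left (g : G) (p : TangentBundle 𝓘(ℝ, E) G) :
    leftForm (tangentMap 𝓘(ℝ, E) 𝓘(ℝ, E) (fun x : G => g * x) p) = leftForm p :=
  leftTriv_mfderiv_mul_left g p.1 p.2

lemma contMDiff_tangentMap_mul_left (g : G) :
    ContMDiff 𝓘(ℝ, E).tangent 𝓘(ℝ, E).tangent ∞
      (tangentMap 𝓘(ℝ, E) 𝓘(ℝ, E) (fun x : G => g * x)) :=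
  (contMDiff_mul_left (I := 𝓘(ℝ, E)) (n := ∞)).contMDiff_tangentMap le_rfl

lemma contMDiff_tangentOne : ContMDiff 𝓘(ℝ, E) 𝓘(ℝ, E).tangent ∞ (tangentOne (E := E) G) := by
  intro u
  rw [Bundle.contMDiffAt_totalSpace]
  refine ⟨contMDiffAt_const, ?_⟩
  refine contMDiffAt_id.congr_of_eventuallyEq (.of_forall fun v => ?_)
  exact tangentCoordChange_self (I := 𝓘(ℝ, E)) (mem_extChartAt_source (1 : G))

lemma leftForm_ne_zero {g : G} {v : TangentSpace 𝓘(ℝ, E) g} (hv : v ≠ 0) :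
    leftForm (⟨g, v⟩ : TangentBundle 𝓘(ℝ, E) G) ≠ 0 := by
  intro h0
  apply hv
  rw [← mulInvariantVectorField_leftTriv g v]
  exact (congrArg (mfderiv 𝓘(ℝ, E) 𝓘(ℝ, E) (fun h : G => g * h) (1 : G)) h0).trans (map_zero _)

variable [FiniteDimensional ℝ E]

lemma contMDiff_leftForm :
    ContMDiff 𝓘(ℝ, E).tangent 𝓘(ℝ, E) ∞ (leftForm : TangentBundle 𝓘(ℝ, E) G → E) := by
  intro p
  have : CompleteSpace E := FiniteDimensional.complete ℝ E
  have hp := mem_chart_source E p.1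
  have h := ((isInvariantFrame_leftFrame (E := E) p.1).contDiffAt_coframe
    ((chartAt E p.1).map_source hp) (chartDeriv (chartAt E p.1) p.1 p.2)).contMDiffAt
  exact (h.comp p (contMDiffAt_stdCoord hp)).congr_of_eventuallyEq (leftForm_eventuallyEq hp)

lemma contDiffOn_leftForm {J : Set ℝ} {c : ℝ → G} {W : ∀ t, TangentSpace 𝓘(ℝ, E) (c t)}
    (hW : ContMDiffOn 𝓘(ℝ, ℝ) 𝓘(ℝ, E).tangent ∞
      (fun t => (⟨c t, W t⟩ : TangentBundle 𝓘(ℝ, E) G)) J) :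
    ContDiffOn ℝ ∞ (fun t => leftForm (⟨c t, W t⟩ : TangentBundle 𝓘(ℝ, E) G)) J :=
  (contMDiff_leftForm.comp_contMDiffOn hW).contDiffOn

/-- In standard coordinates, `leftForm` is `(x, y) ↦ (A x)⁻¹ y`; a tangent vector `(a, b)` at `(x, y)`
is sent to `(A x)⁻¹ (b - DA(a) (A x)⁻¹ y)`. -/
lemma leftFrame_leftFormDeriv {g : G} {p : TangentBundle 𝓘(ℝ, E) G}
    (hp : p.1 ∈ (chartAt E g).source) (V : TangentSpace 𝓘(ℝ, E).tangent p) :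
    leftFrame (chartAt E g) (chartAt E g p.1) (leftFormDeriv p V)
      = (stdCoordDeriv (chartAt E g) p V).2
        - fderiv ℝ (leftFrame (chartAt E g)) (chartAt E g p.1)
            (stdCoordDeriv (chartAt E g) p V).1 (leftForm p) := by
  have : CompleteSpace E := FiniteDimensional.complete ℝ E
  have hx := (chartAt E g).map_source hp
  have hF := isInvariantFrame_leftFrame (E := E) g
  have h1 : leftFormDeriv p V = fderiv ℝ
      (fun q : E × E => (leftFrame (chartAt E g) q.1).inverse q.2) (stdCoord (chartAt E g) p)
      (stdCoordDeriv (chartAt E g) p V) := by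
    refine (congrArg (fun L : TangentSpace 𝓘(ℝ, E).tangent p →L[ℝ] E => L V)
      (leftForm_eventuallyEq hp).mfderiv_eq).trans ?_
    refine (mfderiv_comp_apply (I' := 𝓘(ℝ, E × E)) p
      ((hF.contDiffAt_coframe hx _).contMDiffAt.mdifferentiableAt (by simp))
      ((contMDiffAt_stdCoord hp).mdifferentiableAt (by simp)) V).trans ?_
    exact congrArg (fun L : E × E →L[ℝ] E => L (stdCoordDeriv (chartAt E g) p V))
      mfderiv_eq_fderiv
  rw [h1]
  have h2 := hF.apply_fderiv_coframe hx (chartDeriv (chartAt E g) p.1 p.2)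
    (stdCoordDeriv (chartAt E g) p V).1 (stdCoordDeriv (chartAt E g) p V).2
  rw [← leftTriv_eq_inverse hp] at h2
  exact h2

end LeftForm

/-! ### Left invariant sprays -/

namespace Spray

variable {E : Type*} [NormedAddCommGroup E] [NormedSpace ℝ E] [FiniteDimensional ℝ E]
  {G : Type*} [TopologicalSpace G] [ChartedSpace E G] [Group G] [LieGroup 𝓘(ℝ, E) ∞ G]

variable (S : Spray E G)

/-- The derivative of `leftForm` along the spray at `u ∈ 𝔤`, i.e. the right-hand side of the
equation `y' = drift y` satisfied by left-trivialized geodesic velocities. -/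
def drift (u : E) : E := leftFormDeriv (tangentOne G u) (S.field (tangentOne G u))

variable {S}

/-- Left invariance reduces the derivative of `leftForm` along the spray to the identity. -/
lemma leftFormDeriv_field (hS : S.IsLeftInvariant) {p : TangentBundle 𝓘(ℝ, E) G}
    (hp : p ∈ slit E G) : leftFormDeriv p (S.field p) = S.drift (leftForm p) := by
  rw [drift, ← tangentMap_inv_mul_left, ← hS p.1⁻¹ p hp]
  have h := mfderiv_comp_apply (I' := 𝓘(ℝ, E).tangent) p
    ((contMDiff_leftForm (E := E) (G := G)).contMDiffAt.mdifferentiableAt (by simp)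
      (x := tangentMap 𝓘(ℝ, E) 𝓘(ℝ, E) (fun x : G => p.1⁻¹ * x) p))
    ((contMDiff_tangentMap_mul_left (E := E) p.1⁻¹).contMDiffAt.mdifferentiableAt (by simp)
      (x := p)) (S.field p)
  refine Eq.trans ?_ h
  have h2 : (leftForm : TangentBundle 𝓘(ℝ, E) G → E) ∘
      tangentMap 𝓘(ℝ, E) 𝓘(ℝ, E) (fun x : G => p.1⁻¹ * x) = leftForm :=
    funext fun p' => leftForm_tangentMap_mul_left _ p'
  exact congrArg (fun f : TangentBundle 𝓘(ℝ, E) G → E =>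
    (mfderiv 𝓘(ℝ, E).tangent 𝓘(ℝ, E) f p (S.field p) : E)) h2.symm

lemma stdCoordDeriv_canonicalField (u : E) :
    stdCoordDeriv (chartAt E (1 : G)) (tangentOne G u) (canonicalField (tangentOne G u)) =
      (chartDeriv (chartAt E (1 : G)) 1 u, fderiv ℝ (leftFrame (chartAt E (1 : G)))
        (chartAt E (1 : G) 1) (chartDeriv (chartAt E (1 : G)) 1 u) u) := by
  have h1 : (1 : G) ∈ (chartAt E (1 : G)).source := mem_chart_source E 1
  have hA := (isInvariantFrame_leftFrame (E := E) (1 : G)).hasFDerivAt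
    ((chartAt E (1 : G)).map_source h1)
  have h2 : canonicalField (tangentOne G u) =
      (stdCoordDeriv (chartAt E (1 : G)) (tangentOne G u)).inverse
        (leftFrame (chartAt E (1 : G)) (chartAt E (1 : G) 1) (leftForm (tangentOne G u)),
        fderiv ℝ (fun x => leftFrame (chartAt E (1 : G)) x (leftForm (tangentOne G u)))
          (chartAt E (1 : G) 1) (chartDeriv (chartAt E (1 : G)) 1 u)) := rfl
  rw [h2, (isInvertible_stdCoordDeriv (p := tangentOne G u) h1).self_apply_inverse,
    (hA.clm_apply (hasFDerivAt_const _ _)).fderiv]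
  refine Prod.ext ?_ ?_
  · exact leftFrame_leftTriv h1 _
  · simp [leftForm_one]

variable (S) in
/-- The spray vector field `η` as a map of the model space, where the norm of `E` is available. -/
def etaModel : E → E := S.eta

/-- Both sprays have the same horizontal part, so `η = 𝐆₀ - 𝐆` is read off in the fibre; the
derivative of `leftForm` along `𝐆₀` vanishes. -/
theorem eta_eq_neg_drift {u : E} (hu : u ≠ 0) : S.etaModel u = -S.drift u := by
  have h1 : (1 : G) ∈ (chartAt E (1 : G)).source := mem_chart_source E 1
  have hx := (chartAt E (1 : G)).map_source h1
  have hF := isInvariantFrame_leftFrame (E := E) (1 : G)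
  have hdrift := leftFrame_leftFormDeriv (p := tangentOne G u) h1 (S.field (tangentOne G u))
  rw [S.horizontal_part _ (IsManifold.chart_mem_maximalAtlas 1) _ (tangentOne_mem_slit hu) h1,
    leftForm_one] at hdrift
  have hcan := congrArg Prod.snd (stdCoordDeriv_canonicalField (E := E) (G := G) u)
  have heta : chartDeriv (chartAt E (1 : G)) 1 (S.etaModel u) =
      (stdCoordDeriv (chartAt E (1 : G)) (tangentOne G u) (canonicalField (tangentOne G u)
        - S.field (tangentOne G u))).2 := chartDeriv_chartVector h1 _
  rw [map_sub, Prod.snd_sub, hcan] at heta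
  refine hF.injective hx ((leftFrame_one _).trans (heta.trans (Eq.trans ?_ (map_neg _ _).symm)))
  refine Eq.trans ?_ (congrArg Neg.neg hdrift.symm)
  rw [neg_sub]
  rfl

theorem contDiffOn_drift : ContDiffOn ℝ ∞ S.drift {0}ᶜ := by
  have h1 := S.smooth.comp (contMDiff_tangentOne (E := E) (G := G)).contMDiffOn
    (s := {0}ᶜ) (fun u hu => tangentOne_mem_slit hu)
  have h2 := (contMDiff_leftForm (E := E) (G := G)).contMDiff_tangentMap (m := ∞) le_rfl
  have h3 := (contMDiff_snd_tangentBundle_modelSpace E 𝓘(ℝ, E) (n := ∞)).comp_contMDiffOn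
    (h2.comp_contMDiffOn h1)
  exact h3.contDiffOn

/-- In every preferred chart, `2 G(x, A u) = A η(u) - DA(A u) u`. -/
theorem isFrameSpray (hS : S.IsLeftInvariant) (g : G) :
    IsFrameSpray (leftFrame (chartAt E g)) S.etaModel (S.coeff (chartAt E g))
      (chartAt E g).target where
  contDiffOn := contDiffOn_drift.neg.congr fun u hu => eta_eq_neg_drift hu
  coeff x hx u hu := by
    have hF := isInvariantFrame_leftFrame (E := E) g
    set y := leftFrame (chartAt E g) x u with hy
    set p := stdPoint (chartAt E g) (x, y) with hp
    have hp1 : p.1 ∈ (chartAt E g).source := (chartAt E g).map_target hx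
    have hpx : chartAt E g p.1 = x := (chartAt E g).right_inv hx
    have hpy : chartDeriv (chartAt E g) p.1 p.2 = y := chartDeriv_chartVector hp1 y
    have hpu : leftForm p = u := by
      refine (leftTriv_eq_inverse hp1 p.2).trans ?_
      rw [hpy, hpx, hy, hF.inverse_apply hx]
    have hslit : p ∈ slit E G := fun h0 => by
      rw [h0, map_zero] at hpy
      exact hu (hF.injective hx (by rw [map_zero, ← hy, ← hpy]))
    have h1 := leftFrame_leftFormDeriv hp1 (S.field p)
    rw [leftFormDeriv_field hS hslit, hpu, hpx,
      S.horizontal_part _ (IsManifold.chart_mem_maximalAtlas g) _ hslit hp1, hpy] at h1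
    have h2 : S.coeff (chartAt E g) x y =
      -(1 / 2 : ℝ) • (stdCoordDeriv (chartAt E g) p (S.field p)).2 := rfl
    rw [eta_eq_neg_drift hu, map_neg, h1, h2]
    module

/-! ### Geodesics and linearly parallel vector fields -/

theorem riemannCurvature_one (hS : S.IsLeftInvariant) {u : E} (hu : u ≠ 0) (v : E) :
    S.riemannCurvature 1 u v = frameCurv S.etaModel (lieBracketCLM E G) u v := by
  have : CompleteSpace E := FiniteDimensional.complete ℝ E
  have h1 := mem_chart_source E (1 : G)
  have h := IsFrameSpray.curv_eq (isInvariantFrame_leftFrame (E := E) (1 : G))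
    (isFrameSpray hS 1) lieBracketCLM_swap ((chartAt E (1 : G)).map_source h1) hu v
  rw [leftFrame_one, leftFrame_one, leftFrame_one] at h
  exact (congrArg (chartVector (chartAt E (1 : G)) 1) h).trans (chartVector_chartDeriv h1 _)

lemma hasDerivAt_of_hasMFDerivAt {F : Type*} [NormedAddCommGroup F] [NormedSpace ℝ F] {f : ℝ → F}
    {t : ℝ} {L : TangentSpace 𝓘(ℝ, ℝ) t →L[ℝ] TangentSpace 𝓘(ℝ, F) (f t)}
    (h : HasMFDerivAt 𝓘(ℝ, ℝ) 𝓘(ℝ, F) f t L) : HasDerivAt f (L (1 : ℝ)) t :=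
  have h' : HasFDerivAt f (show ℝ →L[ℝ] F from L) t := h.hasFDerivAt
  h'.hasDerivAt

/-- The left-trivialized velocity of a geodesic is an integral curve of `-η`. -/
lemma hasDerivAt_leftForm (hS : S.IsLeftInvariant) {J : Set ℝ} (hJ : IsOpen J) {c : ℝ → G}
    (hc : S.IsGeodesicOn c J) {t : ℝ} (ht : t ∈ J) :
    HasDerivAt (fun s => leftForm (⟨c s, velocity c s⟩ : TangentBundle 𝓘(ℝ, E) G))
      (-S.etaModel (leftForm (⟨c t, velocity c t⟩ : TangentBundle 𝓘(ℝ, E) G))) t := by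
  have h1 := (hc.integralCurve t ht).hasMFDerivAt (hJ.mem_nhds ht)
  have h2 := ((contMDiff_leftForm (E := E) (G := G)).contMDiffAt.mdifferentiableAt (by simp)
    (x := (⟨c t, velocity c t⟩ : TangentBundle 𝓘(ℝ, E) G))).hasMFDerivAt
  have h3 := hasDerivAt_of_hasMFDerivAt (h2.comp t h1)
  refine h3.congr_deriv ?_
  have hslit : (⟨c t, velocity c t⟩ : TangentBundle 𝓘(ℝ, E) G) ∈ slit E G :=
    hc.velocity_ne_zero t ht
  refine Eq.trans ?_ ((leftFormDeriv_field hS hslit).trans (Eq.trans (neg_neg _).symm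
    (congrArg Neg.neg (eta_eq_neg_drift (leftForm_ne_zero
      (hc.velocity_ne_zero t ht))).symm)))
  exact congrArg (leftFormDeriv _) (one_smul ℝ (S.field _))

/-- The left trivialization `w` of a linearly parallel field satisfies `w' = -M(y, w)`. The equation
at time `t` is the coordinate equation of parallelism in the preferred chart at `c t`. -/
lemma hasDerivAt_leftForm_of_parallel (hS : S.IsLeftInvariant) {J : Set ℝ} (hJ : IsOpen J)
    {c : ℝ → G} (hc : S.IsGeodesicOn c J) {W : ∀ t, TangentSpace 𝓘(ℝ, E) (c t)}
    (hW : S.IsLinearlyParallelOn c W J) {t : ℝ} (ht : t ∈ J) :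
    HasDerivAt (fun s => leftForm (⟨c s, W s⟩ : TangentBundle 𝓘(ℝ, E) G))
      (-frameConn S.etaModel (lieBracketCLM E G)
        (leftForm (⟨c t, velocity c t⟩ : TangentBundle 𝓘(ℝ, E) G))
        (leftForm (⟨c t, W t⟩ : TangentBundle 𝓘(ℝ, E) G))) t := by
  have hF := isInvariantFrame_leftFrame (E := E) (c t)
  have hs := mem_chart_source E (c t)
  have hx := (chartAt E (c t)).map_source hs
  have hJt := hJ.mem_nhds ht
  set e := chartAt E (c t) with he
  set w : ℝ → E := fun s => leftForm (⟨c s, W s⟩ : TangentBundle 𝓘(ℝ, E) G) with hw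
  set u : E := leftForm (⟨c t, velocity c t⟩ : TangentBundle 𝓘(ℝ, E) G) with hu
  have hu0 : u ≠ 0 := leftForm_ne_zero (hc.velocity_ne_zero t ht)
  have hct := hc.smooth.contMDiffAt hJt
  have hAu : leftFrame e (e (c t)) u = chartDeriv e (c t) (velocity c t) :=
    leftFrame_leftTriv hs _
  have hAw : leftFrame e (e (c t)) (w t) = chartDeriv e (c t) (W t) :=
    leftFrame_leftTriv hs _
  have hxd : HasDerivAt (fun s => e (c s)) (leftFrame e (e (c t)) u) t := by
    have h1 := (hct.mdifferentiableAt (by simp)).hasMFDerivAt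
    have h2 := (mdifferentiableAt_atlas (I := 𝓘(ℝ, E)) (ChartedSpace.chart_mem_atlas (c t))
      hs).hasMFDerivAt
    exact (hasDerivAt_of_hasMFDerivAt (h2.comp t h1)).congr_deriv hAu.symm
  have hwd : HasDerivAt w (deriv w t) t :=
    (((contDiffOn_leftForm hW.smooth).contDiffAt hJt).differentiableAt (by simp)).hasDerivAt
  have hz : HasDerivAt (fun s => chartDeriv e (c s) (W s))
      (fderiv ℝ (leftFrame e) (e (c t)) (leftFrame e (e (c t)) u) (w t)
        + leftFrame e (e (c t)) (deriv w t)) t := by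
    have hAw := hF.hasDerivAt_apply hx hxd hwd
    refine hAw.congr_of_eventuallyEq ?_
    filter_upwards [hct.continuousAt.preimage_mem_nhds (e.open_source.mem_nhds hs)] with s hs'
    exact (leftFrame_leftTriv (g := c t) (p := c s) hs' (W s)).symm
  have hpar := congrArg (chartDeriv e (c t)) (hW.covDeriv_eq_zero t ht)
  have hpar' : deriv (fun s => chartDeriv e (c s) (W s)) t
      + S.connCoeff e (e (c t)) (chartDeriv e (c t) (velocity c t)) (chartDeriv e (c t) (W t)) = 0 :=
    (chartDeriv_chartVector hs _).symm.trans (hpar.trans (map_zero _))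
  have hN : S.connCoeff e (e (c t)) (chartDeriv e (c t) (velocity c t)) (chartDeriv e (c t) (W t))
      = leftFrame e (e (c t)) (frameConn S.etaModel (lieBracketCLM E G) u (w t))
        - fderiv ℝ (leftFrame e) (e (c t)) (leftFrame e (e (c t)) u) (w t) := by
    rw [← hAu, ← hAw]
    exact IsFrameSpray.conn_eq hF (isFrameSpray hS (c t)) hx hu0 (w t)
  rw [hN, hz.deriv] at hpar'
  have : deriv w t = -frameConn S.etaModel (lieBracketCLM E G) u (w t) := by
    refine hF.injective hx ?_
    rw [map_neg, eq_neg_iff_add_eq_zero, ← hpar']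
    abel
  rwa [this] at hwd

end Spray

end SprayGeometry

end

open SprayGeometry
theorem theorem1p2 {E : Type*} [NormedAddCommGroup E] [NormedSpace ℝ E] [FiniteDimensional ℝ E]
    {G : Type*} [TopologicalSpace G] [ChartedSpace E G] [Group G] [LieGroup 𝓘(ℝ, E) ∞ G]
    [ConnectedSpace G]
    (S : Spray E G) (hS : S.IsLeftInvariant)
    (J : Set ℝ) (hJ : IsOpen J) (hJ' : J.OrdConnected)
    (c : ℝ → G) (hc : S.IsGeodesicOn c J)
    (W : ∀ t : ℝ, TangentSpace 𝓘(ℝ, E) (c t)) (hW : S.IsLinearlyParallelOn c W J)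
    (y w : ℝ → GroupLieAlgebra 𝓘(ℝ, E) G)
    (hy : ∀ t ∈ J, y t = leftTriv (c t) (velocity c t))
    (hw : ∀ t ∈ J, w t = leftTriv (c t) (W t)) :
    -- `y` is a smooth curve in `𝔤 \ {0}` and an integral curve of `-η`,
    -- and `η` is differentiable at its points
    (SmoothOn y J ∧ ∀ t ∈ J, y t ≠ 0 ∧ DifferentiableAt ℝ S.eta (y t) ∧
      HasDerivAt y (-S.eta (y t)) t) ∧
    -- `w(t)`, `N(t)` and `R(t)` are smooth vector fields along `y`
    SmoothOn w J ∧
    SmoothOn (fun t => S.connOp (y t) (w t)) J ∧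
    SmoothOn (fun t => S.riemannCurvature 1 (y t) (w t)) J ∧
    -- the formulas for `N(t)` and `R(t)`
    ∀ t ∈ J,
      S.connOp (y t) (w t) = -bracketAlong S.eta y w t ∧
      S.riemannCurvature 1 (y t) (w t)
        = bracketAlong S.eta y (fun s => S.connOp (y s) (w s)) t ∧
      S.riemannCurvature 1 (y t) (w t)
        = -bracketAlong S.eta y (bracketAlong S.eta y w) t := by
  -- `𝔤` carries no norm; the calculus takes place in the model space `E`, which is the same type
  let ym : ℝ → E := y
  let wm : ℝ → E := w
  have hη : ContDiffOn ℝ ∞ S.etaModel {0}ᶜ := (Spray.isFrameSpray hS 1).contDiffOn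
  have hyJ : ∀ t ∈ J, ym t = leftForm (⟨c t, velocity c t⟩ : TangentBundle 𝓘(ℝ, E) G) := hy
  have hwJ : ∀ t ∈ J, wm t = leftForm (⟨c t, W t⟩ : TangentBundle 𝓘(ℝ, E) G) := hw
  have hy0 : ∀ t ∈ J, ym t ≠ 0 := fun t ht => by
    rw [hyJ t ht]; exact leftForm_ne_zero (hc.velocity_ne_zero t ht)
  have hyd : ∀ t ∈ J, HasDerivAt ym (-S.etaModel (ym t)) t := fun t ht => by
    rw [hyJ t ht]
    refine (Spray.hasDerivAt_leftForm hS hJ hc ht).congr_of_eventuallyEq ?_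
    filter_upwards [hJ.mem_nhds ht] with s hs using hyJ s hs
  have hwd : ∀ t ∈ J, HasDerivAt wm (-frameConn S.etaModel (lieBracketCLM E G) (ym t) (wm t)) t :=
    fun t ht => by
      rw [hyJ t ht, hwJ t ht]
      refine (Spray.hasDerivAt_leftForm_of_parallel hS hJ hc hW ht).congr_of_eventuallyEq ?_
      filter_upwards [hJ.mem_nhds ht] with s hs using hwJ s hs
  have hys : ContDiffOn ℝ ∞ ym J := contDiffOn_of_hasDerivAt hJ hη.neg hy0 hyd
  have hws : ContDiffOn ℝ ∞ wm J := (contDiffOn_leftForm hW.smooth).congr hwJ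
  have hR : ∀ t ∈ J, S.riemannCurvature 1 (y t) (w t)
      = frameCurv S.etaModel (lieBracketCLM E G) (ym t) (wm t) := fun t ht =>
    Spray.riemannCurvature_one hS (hy0 t ht) (wm t)
  refine ⟨⟨hys, fun t ht => ⟨hy0 t ht, ?_, hyd t ht⟩⟩, hws,
    contDiffOn_frameConnOp (br := lieBracketCLM E G) hη hys hws hy0, (contDiffOn_frameCurv hη hys hws hy0).congr hR,
    fun t ht => ?_⟩
  · exact ((Spray.isFrameSpray hS 1).hasFDerivAt (hy0 t ht)).differentiableAt
  · rw [hR t ht]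
    exact frameConnOp_frameCurv_eq_bracketAlong hJ hη hy0 hyd hwd ht
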